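/- Let $v\in\{2,3\}$, let $\mathcal A_v$ be the quaternion skew field ($v=2$) or the octonion algebra ($v=3$) with standard generators $i_0=1,i_1,\dots,i_{2^v-1}$, and let $Y$ be a Banach space over $\mathcal A_v$, that is, a real Banach space with continuous real-bilinear left and right multiplications by $\mathcal A_v$ and a topological direct sum decomposition $Y=\bigoplus_{l}Y_0i_l$, where the vectors of the real subspace $Y_0$ commute and associate with $\mathcal A_v$. Let $l_\infty(\mathbb Z,Y)$ be the Banach space of bounded sequences $x:\mathbb Z\to Y$ with the supremum norm, and for a Banach space $X$ over $\mathcal A_v$ let $L_q(X)$ be the algebra of bounded real-linear operators on $X$. Let $n\ge 1$ be an integer and let $B\in L_q(l_\infty(\mathbb Z,Y))$ be $n$-periodic, that is, $B$ maps every norm bounded sequence in $l_\infty(\mathbb Z,Y)$ that converges termwise to an element of $l_\infty(\mathbb Z,Y)$ to a sequence of the same kind ($c$-continuity), and $S(n)B=BS(n)$, where $(S(n)x)(k)=x(n+k)$. Let $Y\oplus Y\mathbf i$ be the complexification of $Y$, with $\mathbf i^2=-1$, $\mathbf i$ commuting with $\mathcal A_v$, and $\|x+y\mathbf i\|^2=\|x\|^2+\|y\|^2$.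 Let $\mathbf B(a+b\mathbf i)=Ba+(Bb)\mathbf i$ be the natural extension of $B$ to $l_\infty(\mathbb Z,Y\oplus Y\mathbf i)$. For $M\in S^1=\{M\in\mathbb R\oplus\mathbb R\mathbf i:\ |M|=1\}$ put $\mathcal M=(M^k)_{k\in\mathbb Z}$ and $(D(\mathcal M)x)(k)=M^kx(k)$, and let $\mathbf B(D(\mathcal M))$ denote the Fourier transform of $B$ at $M$, the operator $$(x_0,\dots,x_{n-1})\ \mapsto\ \bigl(M^{-j}\,(\mathbf B(D(\mathcal M)x))(j)\bigr)_{j=0}^{n-1}$$ on $(Y\oplus Y\mathbf i)^n$ with the maximum norm, where on the right $x$ is the $n$-periodic sequence with $x(j)=x_j$ for $0\le j<n$. For $T\in L_q(X)$ let the spectrum $\sigma(T)$ be the set of all $z\in\mathcal A_v$ such that $zI-T$ (with $zI$ the left multiplication by $z$) has no two-sided inverse in $L_q(X)$. Then $$\sigma(\mathbf B)=\bigcup_{M\in S^1}\sigma\bigl(\mathbf B(D(\mathcal M))\bigr).$$ -/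

import Mathlib

open scoped ENNReal

noncomputable section

namespace CayleyDickson

/-! ### The Cayley-Dickson algebras over the reals -/

/-- The underlying real vector space of the Cayley-Dickson algebra `𝒜_v`: `𝒜₀ = ℝ` and
`𝒜_{v+1} = 𝒜_v ⊕ 𝒜_v ℓ`, the pair `(a, b)` standing for `a + b ℓ`. Thus `𝒜₁` is the complex
field, `𝒜₂` the quaternion skew field and `𝒜₃` the octonion algebra. -/
def CD : ℕ → Type
  | 0 => ℝ
  | v + 1 => CD v × CD v

instance instAddCommGroup : (v : ℕ) → AddCommGroup (CD v)
  | 0 => inferInstanceAs (AddCommGroup ℝ)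
  | v + 1 =>
    letI := instAddCommGroup v
    inferInstanceAs (AddCommGroup (CD v × CD v))

instance instModule : (v : ℕ) → Module ℝ (CD v)
  | 0 => inferInstanceAs (Module ℝ ℝ)
  | v + 1 =>
    letI := instModule v
    inferInstanceAs (Module ℝ (CD v × CD v))

/-- The conjugation `(a + b ℓ)* = a* - b ℓ`. -/
def conj : (v : ℕ) → CD v → CD v
  | 0, a => a
  | v + 1, (a, b) => (conj v a, -b)

/-- The doubling product `(a + b ℓ) (c + d ℓ) = (a c - d* b) + (d a + b c*) ℓ`. -/
def mul : (v : ℕ) → CD v → CD v → CD v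
  | 0, a, b => (show ℝ from a) * (show ℝ from b)
  | v + 1, (a, b), (c, d) =>
    (mul v a c - mul v (conj v d) b, mul v d a + mul v b (conj v c))

instance instMul (v : ℕ) : Mul (CD v) := ⟨mul v⟩

/-- The standard generators `i_0 = 1, i_1, …, i_{2^v - 1}` of `𝒜_v`, a basis over the reals, with
`i_{2^v + l} = i_l ℓ` in `𝒜_{v+1}`. -/
def gen : (v : ℕ) → ℕ → CD v
  | 0, _ => (1 : ℝ)
  | v + 1, l => if l < 2 ^ v then (gen v l, 0) else (0, gen v (l - 2 ^ v))

instance instOne (v : ℕ) : One (CD v) := ⟨gen v 0⟩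

/-! ### Banach spaces over `𝒜_v` -/

/-- The structure of a vector space over the Cayley-Dickson algebra `𝒜_v` on a real normed
space `Y` (a Banach space over `𝒜_v` if `Y` is complete): continuous bilinear left and right
multiplications by elements of `𝒜_v` and a topological direct sum decomposition
`Y = Y₀ i_0 ⊕ Y₀ i_1 ⊕ … ⊕ Y₀ i_{2^v - 1}`, where the vectors of the real subspace `Y₀` commute and
associate with `𝒜_v`. -/
class BanachOver (v : ℕ) (Y : Type*) [NormedAddCommGroup Y] [NormedSpace ℝ Y] where
  /-- left multiplication: `lmul a x` is `a x` -/
  lmul : CD v →ₗ[ℝ] Y →L[ℝ] Y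
  /-- right multiplication: `rmul a x` is `x a` -/
  rmul : CD v →ₗ[ℝ] Y →L[ℝ] Y
  /-- the coordinate `x_l ∈ Y₀` of a vector `x` -/
  coord : Fin (2 ^ v) → Y →L[ℝ] Y
  one_lmul : ∀ x, lmul 1 x = x
  one_rmul : ∀ x, rmul 1 x = x
  sum_coord : ∀ x, ∑ l : Fin (2 ^ v), lmul (gen v l) (coord l x) = x
  coord_gen : ∀ (l m s : Fin (2 ^ v)) (x : Y),
    coord m (lmul (gen v l) (coord s x)) = if m = l then coord s x else 0
  lmul_coord_comm : ∀ a s x, lmul a (coord s x) = rmul a (coord s x)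
  lmul_lmul_coord : ∀ a b s x, lmul a (lmul b (coord s x)) = lmul (a * b) (coord s x)
  rmul_rmul_coord : ∀ a b s x, rmul a (rmul b (coord s x)) = rmul (b * a) (coord s x)

/-- The spectrum of a bounded real-linear operator `T` on a Banach space `X` over `𝒜_v`: the set of
all `z` in `𝒜_v` such that `z I - T` has no bounded two-sided inverse. -/
def spectrum (v : ℕ) {X : Type*} [NormedAddCommGroup X] [NormedSpace ℝ X] [BanachOver v X]
    (T : X →L[ℝ] X) : Set (CD v) :=
  {z | ¬ IsUnit (BanachOver.lmul z - T)}

/-! ### The complexification `Y ⊕ Y𝐢` -/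

/-- `Y ⊕ Y𝐢`, the pair `(x, y)` standing for `x + y𝐢`, with the norm
`‖x + y𝐢‖² = ‖x‖² + ‖y‖²`. -/
abbrev Cplx (Y : Type*) : Type _ := WithLp 2 (Y × Y)

section Cplx

variable {Y Z : Type*} [NormedAddCommGroup Y] [NormedSpace ℝ Y] [NormedAddCommGroup Z]
  [NormedSpace ℝ Z]

/-- `x + y𝐢 ↦ x`. -/
def Cplx.re : Cplx Y →L[ℝ] Y :=
  (ContinuousLinearMap.fst ℝ Y Y).comp
    (WithLp.prodContinuousLinearEquiv 2 ℝ Y Y : Cplx Y →L[ℝ] Y × Y)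

/-- `x + y𝐢 ↦ y`. -/
def Cplx.im : Cplx Y →L[ℝ] Y :=
  (ContinuousLinearMap.snd ℝ Y Y).comp
    (WithLp.prodContinuousLinearEquiv 2 ℝ Y Y : Cplx Y →L[ℝ] Y × Y)

/-- `x ↦ x + 0𝐢`. -/
def Cplx.inRe : Y →L[ℝ] Cplx Y :=
  ((WithLp.prodContinuousLinearEquiv 2 ℝ Y Y).symm : Y × Y →L[ℝ] Cplx Y).comp
    (ContinuousLinearMap.inl ℝ Y Y)

/-- `y ↦ 0 + y𝐢`. -/
def Cplx.inIm : Y →L[ℝ] Cplx Y :=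
  ((WithLp.prodContinuousLinearEquiv 2 ℝ Y Y).symm : Y × Y →L[ℝ] Cplx Y).comp
    (ContinuousLinearMap.inr ℝ Y Y)

/-- The operator `x + y𝐢 ↦ A x + (A y)𝐢` induced by an operator `A`, as a linear function
of `A`. -/
def Cplx.map : (Y →L[ℝ] Z) →ₗ[ℝ] (Cplx Y →L[ℝ] Cplx Z) where
  toFun A := Cplx.inRe ∘L A ∘L Cplx.re + Cplx.inIm ∘L A ∘L Cplx.im
  map_add' A A' := by
    simp only [ContinuousLinearMap.add_comp, ContinuousLinearMap.comp_add]
    abel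
  map_smul' c A := by
    simp only [ContinuousLinearMap.smul_comp, ContinuousLinearMap.comp_smul, smul_add,
      RingHom.id_apply]

/-- Multiplication by a complex number `c = c.re + c.im 𝐢` on `Y ⊕ Y𝐢`:
`c (x + y𝐢) = (c.re x - c.im y) + (c.im x + c.re y)𝐢`. -/
def Cplx.smul (c : ℂ) : Cplx Y →L[ℝ] Cplx Y :=
  c.re • ContinuousLinearMap.id ℝ (Cplx Y)
    + c.im • (Cplx.inIm ∘L Cplx.re - Cplx.inRe ∘L Cplx.im)

theorem Cplx.ext_iff' {x y : Cplx Y} : x = y ↔ x.fst = y.fst ∧ x.snd = y.snd := by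
  rw [← (WithLp.prodContinuousLinearEquiv 2 ℝ Y Y).injective.eq_iff, Prod.ext_iff]
  rfl

@[simp] theorem Cplx.map_fst (A : Y →L[ℝ] Z) (x : Cplx Y) : (Cplx.map A x).fst = A x.fst := by
  simp [Cplx.map, Cplx.inRe, Cplx.inIm, Cplx.re, Cplx.im]

@[simp] theorem Cplx.map_snd (A : Y →L[ℝ] Z) (x : Cplx Y) : (Cplx.map A x).snd = A x.snd := by
  simp [Cplx.map, Cplx.inRe, Cplx.inIm, Cplx.re, Cplx.im]

theorem Cplx.norm_smul_le (c : ℂ) : ‖(Cplx.smul c : Cplx Y →L[ℝ] Cplx Y)‖ ≤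
    ‖c‖ * (‖ContinuousLinearMap.id ℝ (Cplx Y)‖
      + ‖(Cplx.inIm ∘L Cplx.re - Cplx.inRe ∘L Cplx.im : Cplx Y →L[ℝ] Cplx Y)‖) := by
  refine (norm_add_le _ _).trans ?_
  rw [norm_smul, norm_smul, mul_add]
  gcongr
  · exact Complex.abs_re_le_norm c
  · exact Complex.abs_im_le_norm c

/-- `Y ⊕ Y𝐢` as a vector space over `𝒜_v`, the elements of `𝒜_v` commuting with `𝐢`. -/
instance instBanachOverCplx (v : ℕ) [BanachOver v Y] : BanachOver v (Cplx Y) where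
  lmul := Cplx.map ∘ₗ BanachOver.lmul
  rmul := Cplx.map ∘ₗ BanachOver.rmul
  coord l := Cplx.map (BanachOver.coord (v := v) l)
  one_lmul x := by rw [Cplx.ext_iff']; constructor <;> simp [BanachOver.one_lmul]
  one_rmul x := by rw [Cplx.ext_iff']; constructor <;> simp [BanachOver.one_rmul]
  sum_coord x := by
    rw [← (WithLp.prodContinuousLinearEquiv 2 ℝ Y Y).injective.eq_iff, map_sum, Prod.ext_iff]
    constructor <;> simp [Prod.fst_sum, Prod.snd_sum, BanachOver.sum_coord]
  coord_gen l m s x := by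
    rw [Cplx.ext_iff']; constructor <;> simp [BanachOver.coord_gen] <;> split_ifs <;> simp
  lmul_coord_comm a s x := by rw [Cplx.ext_iff']; constructor <;> simp [BanachOver.lmul_coord_comm]
  lmul_lmul_coord a b s x := by rw [Cplx.ext_iff']; constructor <;> simp [BanachOver.lmul_lmul_coord]
  rmul_rmul_coord a b s x := by rw [Cplx.ext_iff']; constructor <;> simp [BanachOver.rmul_rmul_coord]

end Cplx

/-- The finite direct sum `⨁_{j ∈ ι} Y` with the maximum norm as a vector space over `𝒜_v`, with
coordinatewise multiplications. -/
instance instBanachOverPi (v : ℕ) {ι : Type*} [Fintype ι] {Y : Type*} [NormedAddCommGroup Y]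
    [NormedSpace ℝ Y] [BanachOver v Y] : BanachOver v (ι → Y) where
  lmul :=
    { toFun := fun a => ContinuousLinearMap.piMap fun _ => BanachOver.lmul a
      map_add' := fun a b => by ext x i; simp
      map_smul' := fun c a => by ext x i; simp }
  rmul :=
    { toFun := fun a => ContinuousLinearMap.piMap fun _ => BanachOver.rmul a
      map_add' := fun a b => by ext x i; simp
      map_smul' := fun c a => by ext x i; simp }
  coord l := ContinuousLinearMap.piMap fun _ => BanachOver.coord l
  one_lmul x := by ext i; simp [BanachOver.one_lmul]
  one_rmul x := by ext i; simp [BanachOver.one_rmul]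
  sum_coord x := by ext i; simp [BanachOver.sum_coord]
  coord_gen l m s x := by ext i; simp [BanachOver.coord_gen]; split_ifs <;> simp
  lmul_coord_comm a s x := by ext i; simp [BanachOver.lmul_coord_comm]
  lmul_lmul_coord a b s x := by ext i; simp [BanachOver.lmul_lmul_coord]
  rmul_rmul_coord a b s x := by ext i; simp [BanachOver.rmul_rmul_coord]

/-! ### The space of bounded two-sided sequences -/

/-- The space `l_∞(ℤ, Y)` of bounded two-sided sequences with the supremum norm. -/
abbrev LInf (Y : Type*) [NormedAddCommGroup Y] : Type _ := lp (fun _ : ℤ => Y) ∞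

section LInf

variable {Y Z : Type*} [NormedAddCommGroup Y] [NormedSpace ℝ Y] [NormedAddCommGroup Z]
  [NormedSpace ℝ Z]

theorem LInf.memℓp_of_le {Y Z : Type*} [NormedAddCommGroup Y] [NormedAddCommGroup Z] (x : LInf Y) (y : ℤ → Z) (C : ℝ) (h : ∀ k, ‖y k‖ ≤ C * ‖x‖) :
    Memℓp y ∞ :=
  memℓp_infty ⟨C * ‖x‖, by rintro _ ⟨k, rfl⟩; exact h k⟩

theorem LInf.norm_apply_le_of_bound (A : ℤ → Y →L[ℝ] Z) (C : ℝ) (hA : ∀ k, ‖A k‖ ≤ C)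
    (x : LInf Y) (k : ℤ) : ‖A k (x k)‖ ≤ C * ‖x‖ :=
  ((A k).le_opNorm _).trans (mul_le_mul (hA k) (lp.norm_apply_le_norm (by simp) x k)
    (norm_nonneg _) ((norm_nonneg _).trans (hA k)))

/-- The operator of multiplication on a bounded sequence `A` of operators:
`(diag A x)(k) = A k (x k)`. -/
def LInf.diag (A : ℤ → Y →L[ℝ] Z) (C : ℝ) (hA : ∀ k, ‖A k‖ ≤ C) : LInf Y →L[ℝ] LInf Z :=
  LinearMap.mkContinuous
    { toFun := fun x => ⟨fun k => A k (x k),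
        LInf.memℓp_of_le x _ C (LInf.norm_apply_le_of_bound A C hA x)⟩
      map_add' := fun x y => by ext k; simp; rfl
      map_smul' := fun c x => by ext k; simp } C
    fun x => lp.norm_le_of_forall_le' _ (LInf.norm_apply_le_of_bound A C hA x)

@[simp] theorem LInf.diag_apply (A : ℤ → Y →L[ℝ] Z) (C : ℝ) (hA : ∀ k, ‖A k‖ ≤ C) (x : LInf Y)
    (k : ℤ) : LInf.diag A C hA x k = A k (x k) := rfl

/-- The termwise application `(LInf.map A x)(k) = A (x k)` of an operator `A`, as a linear function
of `A`. -/
def LInf.map : (Y →L[ℝ] Z) →ₗ[ℝ] (LInf Y →L[ℝ] LInf Z) where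
  toFun A := LInf.diag (fun _ => A) ‖A‖ fun _ => le_rfl
  map_add' A A' := by ext x k; simp
  map_smul' c A := by ext x k; simp

@[simp] theorem LInf.map_apply (A : Y →L[ℝ] Z) (x : LInf Y) (k : ℤ) :
    LInf.map A x k = A (x k) := rfl

/-- `l_∞(ℤ, Y)` as a vector space over `𝒜_v`, with termwise multiplications. -/
instance instBanachOverLInf (v : ℕ) [BanachOver v Y] : BanachOver v (LInf Y) where
  lmul := LInf.map ∘ₗ BanachOver.lmul
  rmul := LInf.map ∘ₗ BanachOver.rmul
  coord l := LInf.map (BanachOver.coord l)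
  one_lmul x := by ext k; simp [BanachOver.one_lmul]
  one_rmul x := by ext k; simp [BanachOver.one_rmul]
  sum_coord x := by
    ext k
    rw [lp.coeFn_sum]
    simp [BanachOver.sum_coord]
  coord_gen l m s x := by ext k; simp [BanachOver.coord_gen]; split_ifs <;> simp
  lmul_coord_comm a s x := by ext k; simp [BanachOver.lmul_coord_comm]
  lmul_lmul_coord a b s x := by ext k; simp [BanachOver.lmul_lmul_coord]
  rmul_rmul_coord a b s x := by ext k; simp [BanachOver.rmul_rmul_coord]

/-- The shift operator `(S(m) x)(k) = x(m + k)`. -/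
def shift (m : ℤ) : LInf Y →L[ℝ] LInf Y :=
  LinearMap.mkContinuous
    { toFun := fun x => ⟨fun k => x (m + k), LInf.memℓp_of_le x _ 1 fun k => by
        simpa using lp.norm_apply_le_norm (by simp) x (m + k)⟩
      map_add' := fun x y => by ext k; simp; rfl
      map_smul' := fun c x => by ext k; simp } 1
    fun x => lp.norm_le_of_forall_le' _ fun k => by
        simpa using lp.norm_apply_le_norm (by simp) x (m + k)

/-- A sequence `u` in `l_∞(ℤ, Y)` is `c`-convergent to `x` if it converges to `x` termwise. -/
def CConverges (u : ℕ → LInf Y) (x : LInf Y) : Prop :=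
  ∀ k : ℤ, Filter.Tendsto (fun m => ‖u m k - x k‖) Filter.atTop (nhds 0)

/-- A bounded operator on `l_∞(ℤ, Y)` is `c`-continuous if it maps norm bounded `c`-convergent
sequences to `c`-convergent sequences. -/
def CContinuous (B : LInf Y →L[ℝ] LInf Y) : Prop :=
  ∀ u : ℕ → LInf Y, (∃ C : ℝ, ∀ m, ‖u m‖ ≤ C) → (∃ x, CConverges u x) →
    ∃ y, CConverges (fun m => B (u m)) y

/-- `B` belongs to `L_q^{n,per}(l_∞(ℤ, Y))`: it is `c`-continuous and commutes with `S(n)`. -/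
structure IsPeriodic (n : ℕ) (B : LInf Y →L[ℝ] LInf Y) : Prop where
  cContinuous : CContinuous B
  shift_comm : shift (n : ℤ) ∘L B = B ∘L shift (n : ℤ)

/-- The natural extension `𝐁(a + b𝐢) = B a + (B b)𝐢` of an operator `B` from `l_∞(ℤ, Y)` to
`l_∞(ℤ, Y ⊕ Y𝐢)`. -/
def extension (B : LInf Y →L[ℝ] LInf Y) : LInf (Cplx Y) →L[ℝ] LInf (Cplx Y) :=
  LInf.map Cplx.inRe ∘L B ∘L LInf.map Cplx.re + LInf.map Cplx.inIm ∘L B ∘L LInf.map Cplx.im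

/-- The multiplication operator `D(𝓜)` on `l_∞(ℤ, Y ⊕ Y𝐢)` for `𝓜 = (M^k)_{k ∈ ℤ}`, where `M` is a
complex number of absolute value one: `(D(𝓜) x)(k) = M^k x(k)`. -/
def D (M : Circle) : LInf (Cplx Y) →L[ℝ] LInf (Cplx Y) :=
  LInf.diag (fun k => Cplx.smul ((M : ℂ) ^ k))
    (‖ContinuousLinearMap.id ℝ (Cplx Y)‖
      + ‖(Cplx.inIm ∘L Cplx.re - Cplx.inRe ∘L Cplx.im : Cplx Y →L[ℝ] Cplx Y)‖) fun k => by
    refine (Cplx.norm_smul_le (Y := Y) ((M : ℂ) ^ k)).trans_eq ?_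
    rw [norm_zpow, Circle.norm_coe, one_zpow, one_mul]

/-- The `n`-periodic sequence in `Z` with given values over a period. -/
def periodicSeq (n : ℕ) [NeZero n] : (ZMod n → Z) →L[ℝ] LInf Z :=
  LinearMap.mkContinuous
    { toFun := fun x => ⟨fun k => x (k : ZMod n), memℓp_infty ⟨‖x‖, by
        rintro _ ⟨k, rfl⟩; exact norm_le_pi_norm x _⟩⟩
      map_add' := fun x y => by ext k; simp; rfl
      map_smul' := fun c x => by ext k; simp } 1
    fun x => lp.norm_le_of_forall_le' _ fun k => by
      simpa using norm_le_pi_norm x (k : ZMod n)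

/-- The restriction of a two-sided sequence to the indices `0, 1, …, n - 1`. -/
def window (n : ℕ) [NeZero n] : LInf Z →L[ℝ] (ZMod n → Z) :=
  ContinuousLinearMap.pi fun j => lp.evalCLM ℝ (fun _ : ℤ => Z) ∞ (j.val : ℤ)

/-- The Fourier transform at `M` of an `n`-periodic operator `B`: the operator
`(x_0, …, x_{n-1}) ↦ (M^{-j} (𝐁 (D(𝓜) x))(j))_{j = 0, …, n-1}` on `⨁_{j=0}^{n-1} (Y ⊕ Y𝐢)`, where in
`D(𝓜) x` the tuple `x` is regarded as an `n`-periodic sequence. -/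
def fourier (n : ℕ) [NeZero n] (B : LInf Y →L[ℝ] LInf Y) (M : Circle) :
    (ZMod n → Cplx Y) →L[ℝ] (ZMod n → Cplx Y) :=
  window n ∘L D M⁻¹ ∘L extension B ∘L D M ∘L periodicSeq n

end LInf

end CayleyDickson

end

/-! Since `zI` acts termwise and is its own Fourier transform, everything reduces to
`isUnit_extension_iff`: for a periodic `c`-continuous operator, the extension `T` is invertible iff
all its Fourier transforms (`symbol n T M`) are. The setting is the real Banach algebra
`periodicOperators n Y` of operators commuting with `S(n)` and `𝐢`. It contains `S(n)` and the
complex numbers centrally.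

The sequences with `S(n) y = M^n y` are exactly those of the form `twist n M x`. Every `T` in the
algebra preserves this eigenspace and acts on it as its symbol, so `T ↦ symbol n T M` is
multiplicative. The inverse of an invertible `T` again lies in the algebra, hence the symbols of `T`
are invertible.

The converse is an Allan-Douglas localization over the central element `S(n)` (`isUnit_of_local`).
If `T` has no left inverse, it lies in a maximal left ideal `L`. By Schur and Gelfand-Mazur `S(n)`
is a complex number `z` modulo `L`, and boundedness of the powers of `S(n)` and of its inverse
forces `|z| = 1`. It remains to see that `T` is locally a unit: modulo the closed ideal generated by
`S(n) - M^n`, it equals the block diagonal operator built from its symbol at `M`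
(`exists_norm_sub_blockDiag_lt`), and block diagonal operators multiply like their symbols. The
approximation rests on `c`-continuity, which makes a block of values of `T x` depend little on
distant blocks of `x`.

The algebras are kept real because the given norm on `Y ⊕ Y𝐢` need not be homogeneous for complex
scalars; the complex numbers enter through a homomorphism `φ`. -/

/-! ### Complex spectral values in real algebras -/

/-- An element `s` of a real algebra mapped into a complex Banach algebra has a complex number
`a + b𝐢` in its spectrum, in the sense that `(s - a)² + b²` is not invertible. -/
theorem exists_not_isUnit_sub_sq_add_sq {R E : Type*} [Ring R] [Algebra ℝ R] [NormedRing E]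
    [NormedAlgebra ℂ E] [CompleteSpace E] [Nontrivial E] (f : R →+* E)
    (hf : ∀ r : ℝ, f (algebraMap ℝ R r) = algebraMap ℂ E r) (s : R) :
    ∃ z : ℂ, ¬ IsUnit ((s - algebraMap ℝ R z.re) ^ 2 + algebraMap ℝ R (z.im ^ 2)) := by
  obtain ⟨z, hz⟩ := spectrum.nonempty (f s)
  refine ⟨z, fun hu => hz ?_⟩
  have hcomm : Commute (algebraMap ℂ E z - f s) (algebraMap ℂ E (starRingEnd ℂ z) - f s) :=
    ((Algebra.commute_algebraMap_left _ _).sub_right (Algebra.commute_algebraMap_left _ _)).sub_left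
      ((Algebra.commute_algebraMap_right _ _).sub_right (Commute.refl _))
  refine (hcomm.isUnit_mul_iff.1 ?_).1
  convert hu.map f using 1
  have hz1 : z + starRingEnd ℂ z = z.re + z.re := by rw [Complex.add_conj]; push_cast; ring
  have hz2 : z * starRingEnd ℂ z = z.re * z.re + (z.im ^ 2 : ℝ) := by
    rw [Complex.mul_conj, Complex.normSq_apply]; push_cast; ring
  have h1 := congrArg (algebraMap ℂ E) hz1
  have h2 := congrArg (algebraMap ℂ E) hz2
  rw [map_add, map_add] at h1
  rw [map_mul, map_add, map_mul] at h2
  rw [map_add, map_pow, map_sub, hf, hf, pow_two]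
  calc (algebraMap ℂ E z - f s) * (algebraMap ℂ E (starRingEnd ℂ z) - f s)
      = algebraMap ℂ E z * algebraMap ℂ E (starRingEnd ℂ z) -
        (algebraMap ℂ E z + algebraMap ℂ E (starRingEnd ℂ z)) * f s + f s * f s := by
        rw [add_mul, Algebra.commutes (starRingEnd ℂ z) (f s)]
        noncomm_ring
    _ = _ := by
        rw [h1, h2, sub_mul, mul_sub, mul_sub, ← Algebra.commutes (z.re : ℂ) (f s)]
        noncomm_ring

/-- Precomposition, as an antihomomorphism into the operators on the complex dual space. -/
noncomputable def ContinuousLinearMap.complexTranspose (V : Type*) [NormedAddCommGroup V]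
    [NormedSpace ℝ V] : (V →L[ℝ] V) →+* ((V →L[ℝ] ℂ) →L[ℂ] (V →L[ℝ] ℂ))ᵐᵒᵖ where
  toFun R := MulOpposite.op <| LinearMap.mkContinuous
      { toFun := fun f => f ∘L R
        map_add' := fun f g => by ext; simp
        map_smul' := fun c f => by ext; simp } ‖R‖
      fun f => by
        rw [mul_comm]
        exact f.opNorm_comp_le R
  map_one' := MulOpposite.unop_injective (by ext; rfl)
  map_mul' _ _ := MulOpposite.unop_injective (by ext; rfl)
  map_zero' := MulOpposite.unop_injective (by ext f x; exact map_zero f)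
  map_add' R R' := MulOpposite.unop_injective (by ext f x; exact map_add f (R x) (R' x))

/-- Real-linear functionals with values in `ℂ` form a complex Banach space, nonzero by Hahn-Banach,
on which `S` acts by transposition. The spectrum there is nonempty, and reversing the order of
products does not affect invertibility. -/
theorem ContinuousLinearMap.exists_not_isUnit_sub_sq_add_sq {V : Type*} [NormedAddCommGroup V]
    [NormedSpace ℝ V] [Nontrivial V] (S : V →L[ℝ] V) :
    ∃ z : ℂ, ¬ IsUnit ((S - algebraMap ℝ _ z.re) ^ 2 + algebraMap ℝ _ (z.im ^ 2)) := by
  have : Nontrivial (V →L[ℝ] ℂ) := by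
    obtain ⟨x, hx⟩ := exists_ne (0 : V)
    obtain ⟨g, -, hg⟩ := exists_dual_vector ℝ x (norm_ne_zero_iff.2 hx)
    refine ⟨⟨Complex.ofRealCLM ∘L g, 0, fun h => hx ?_⟩⟩
    have := congrArg (fun f => f x) h
    simpa [hg] using this
  refine _root_.exists_not_isUnit_sub_sq_add_sq
    (E := ((V →L[ℝ] ℂ) →L[ℂ] (V →L[ℝ] ℂ))ᵐᵒᵖ) (complexTranspose V) (fun r => ?_) S
  refine MulOpposite.unop_injective ?_
  ext f x
  exact map_smul f r x

/-! ### The local principle for a central element -/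

section LocalPrinciple

variable {A : Type*} [NormedRing A] [NormedAlgebra ℝ A] [CompleteSpace A]

/-- A central element outside a maximal left ideal acts invertibly on the quotient. -/
theorem Ideal.isUnit_smul_id_of_notMem (L : Ideal A) [hL : L.IsMaximal] {c : A}
    (hc : ∀ a, c * a = a * c) (hcL : c ∉ L) :
    IsUnit (c • ContinuousLinearMap.id ℝ (A ⧸ L)) := by
  rw [ContinuousLinearMap.isUnit_iff_bijective]
  constructor
  · rw [injective_iff_map_eq_zero]
    intro x hx
    induction x using Submodule.Quotient.induction_on with | _ a => ?_
    have hca : c * a ∈ L := by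
      rw [← smul_eq_mul, ← Submodule.Quotient.mk_eq_zero]
      exact hx
    rw [Submodule.Quotient.mk_eq_zero]
    by_contra ha
    obtain ⟨r, l, hl, h⟩ := hL.exists_inv ha
    refine hcL ?_
    have : c = r * (c * a) + c * l := by
      rw [← mul_assoc, ← hc r, mul_assoc, ← mul_add, h, mul_one]
    rw [this]
    exact L.add_mem (L.mul_mem_left _ hca) (L.mul_mem_left _ hl)
  · intro x
    induction x using Submodule.Quotient.induction_on with | _ b => ?_
    obtain ⟨r, l, hl, h⟩ := hL.exists_inv hcL
    refine ⟨Submodule.Quotient.mk (b * r), ?_⟩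
    change Submodule.Quotient.mk (c * (b * r)) = _
    rw [Submodule.Quotient.eq]
    have : c * (b * r) - b = -(b * l) := by
      rw [hc, mul_assoc, sub_eq_iff_eq_add, neg_add_eq_sub, eq_sub_iff_add_eq, ← mul_add, h,
        mul_one]
    rw [this]
    exact L.neg_mem (L.mul_mem_left _ hl)

/-- Schur's lemma: modulo a maximal left ideal, a central element of a real Banach algebra that
contains the complex numbers centrally is a complex number. -/
theorem Ideal.IsMaximal.exists_sub_mem {L : Ideal A} (hL : L.IsMaximal) (φ : ℂ →ₐ[ℝ] A)
    (hφ : ∀ z a, φ z * a = a * φ z) {s : A} (hs : ∀ a, s * a = a * s) :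
    ∃ z, s - φ z ∈ L := by
  have : Nontrivial (A ⧸ L) := Submodule.Quotient.nontrivial_iff.2 hL.ne_top
  obtain ⟨z, hz⟩ := (s • ContinuousLinearMap.id ℝ (A ⧸ L)).exists_not_isUnit_sub_sq_add_sq
  by_contra! h
  have hcen : ∀ w a, (s - φ w) * a = a * (s - φ w) := fun w a => by
    rw [sub_mul, mul_sub, hs, hφ]
  refine hz ?_
  -- The real quadratic in `s` splits over `φ` into the factors for `z` and its conjugate; if
  -- neither lies in `L`, both act invertibly on the quotient.
  have key := (L.isUnit_smul_id_of_notMem (hcen z) (h z)).mul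
    (L.isUnit_smul_id_of_notMem (hcen _) (h (starRingEnd ℂ z)))
  convert key using 1
  have hprod : (s - φ z) * (s - φ (starRingEnd ℂ z)) =
      (s - algebraMap ℝ A z.re) * (s - algebraMap ℝ A z.re) + algebraMap ℝ A (z.im ^ 2) := by
    have h1 : φ z + φ (starRingEnd ℂ z) = 2 * algebraMap ℝ A z.re := by
      rw [← map_add, Complex.add_conj, ← map_ofNat (algebraMap ℝ A) 2, ← map_mul,
        ← AlgHom.commutes φ]
      rfl
    have h2 : φ z * φ (starRingEnd ℂ z) =
        algebraMap ℝ A z.re * algebraMap ℝ A z.re + algebraMap ℝ A (z.im ^ 2) := by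
      rw [← map_mul, Complex.mul_conj, ← map_mul, ← map_add, ← AlgHom.commutes φ,
        Complex.normSq_apply, pow_two]
      rfl
    calc (s - φ z) * (s - φ (starRingEnd ℂ z))
        = s * s - (φ z + φ (starRingEnd ℂ z)) * s + φ z * φ (starRingEnd ℂ z) := by
          rw [add_mul, hφ (starRingEnd ℂ z) s]; noncomm_ring
      _ = _ := by
          rw [h1, h2, sub_mul, mul_sub, mul_sub, ← Algebra.commutes z.re s]; noncomm_ring
  have hsub : ∀ y : A ⧸ L, (s • ContinuousLinearMap.id ℝ (A ⧸ L) - algebraMap ℝ _ z.re) y =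
      (s - algebraMap ℝ A z.re) • y := fun y => by
    rw [sub_smul, algebraMap_smul]
    rfl
  ext x
  change (_ : A ⧸ L) = (s - φ z) • (s - φ (starRingEnd ℂ z)) • x
  rw [smul_smul, hprod, add_smul, mul_smul, algebraMap_smul, ← hsub, ← hsub, pow_two]
  rfl

/-- Modulo `L`, `t ^ k` is `φ w ^ k`, so `1 - φ (w⁻¹ ^ k) * t ^ k` lies in `L`. If `‖w‖ > 1`, this
tends to `1` because the powers of `t` are bounded, and a proper ideal has no element at distance
less than one from `1`. -/
theorem Ideal.norm_le_one_of_sub_mem {L : Ideal A} (hL : L ≠ ⊤) (φ : ℂ →ₐ[ℝ] A) {t : A}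
    (ht : ∀ a, t * a = a * t) {C : ℝ} (hC : ∀ k : ℕ, ‖t ^ k‖ ≤ C) {w : ℂ} (hw : t - φ w ∈ L) :
    ‖w‖ ≤ 1 := by
  by_contra! h
  have hw0 : w ≠ 0 := by rintro rfl; simp at h; linarith
  have hφ : Continuous φ := φ.toLinearMap.continuous_of_finiteDimensional
  have hlim : Filter.Tendsto (fun k : ℕ => ‖φ (w⁻¹ ^ k)‖ * C) Filter.atTop (nhds 0) := by
    have h1 : Filter.Tendsto (fun k : ℕ => w⁻¹ ^ k) Filter.atTop (nhds 0) :=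
      tendsto_pow_atTop_nhds_zero_of_norm_lt_one (by rw [norm_inv]; exact inv_lt_one_of_one_lt₀ h)
    simpa using ((hφ.tendsto 0).comp h1).norm.mul_const C
  obtain ⟨k, hk⟩ := (hlim.eventually (gt_mem_nhds one_pos)).exists
  refine hL (L.eq_top_of_norm_lt_one (x := 1 - φ (w⁻¹ ^ k) * t ^ k) ?_ ?_)
  · have h1 : t ^ k - φ w ^ k ∈ L := by
      rw [← (show Commute t (φ w) from ht _).geom_sum₂_mul]
      exact L.mul_mem_left _ hw
    have h2 : 1 - φ (w⁻¹ ^ k) * t ^ k = -(φ (w⁻¹ ^ k) * (t ^ k - φ w ^ k)) := by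
      rw [mul_sub, ← map_pow, ← map_mul, ← mul_pow, inv_mul_cancel₀ hw0, one_pow, map_one, neg_sub]
    rw [h2]
    exact L.neg_mem (L.mul_mem_left _ h1)
  · rw [sub_sub_cancel]
    refine ((norm_mul_le _ _).trans ?_).trans_lt hk
    gcongr
    exact hC k

/-- Let `u` be a central element of a real Banach algebra containing the complex numbers centrally
and let both `u` and `u⁻¹` be power bounded. If `T` is invertible modulo the closed ideal generated
by `u - M` for every `M` on the unit circle, then `T` has a left inverse. -/
theorem exists_left_inv_of_local (φ : ℂ →ₐ[ℝ] A) (hφ : ∀ z a, φ z * a = a * φ z)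
    (u : Aˣ) (hu : ∀ a : A, u * a = a * u) (C : ℝ) (hC : ∀ k : ℕ, ‖((u : A)) ^ k‖ ≤ C)
    (hC' : ∀ k : ℕ, ‖((u⁻¹ : Aˣ) : A) ^ k‖ ≤ C) (T : A)
    (hT : ∀ M : Circle, ∃ U : Aˣ, ∀ ε > 0, ∃ a, ‖T - U - a * (u - φ M)‖ < ε) :
    ∃ R, R * T = 1 := by
  by_contra hR
  have hspan : Ideal.span {T} ≠ ⊤ := fun h => by
    rw [Ideal.eq_top_iff_one, Ideal.mem_span_singleton'] at h
    exact hR h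
  obtain ⟨L, hL, hTL⟩ := Ideal.exists_le_maximal _ hspan
  replace hTL : T ∈ L := hTL (Ideal.mem_span_singleton_self T)
  have hunit : ∀ U : Aˣ, (U : A) ∉ L := fun U hU => hL.ne_top (L.eq_top_of_isUnit_mem hU U.isUnit)
  obtain ⟨z, hz⟩ := hL.exists_sub_mem φ hφ hu
  have hz0 : z ≠ 0 := by
    rintro rfl
    rw [map_zero, sub_zero] at hz
    exact hunit u hz
  have hu' : ∀ a : A, ((u⁻¹ : Aˣ) : A) * a = a * ((u⁻¹ : Aˣ) : A) := fun a =>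
    (show Commute (u : A) a from hu a).units_inv_left
  have hz' : ((u⁻¹ : Aˣ) : A) - φ z⁻¹ ∈ L := by
    have : ((u⁻¹ : Aˣ) : A) - φ z⁻¹ = -(((u⁻¹ : Aˣ) : A) * φ z⁻¹ * (u - φ z)) := by
      rw [mul_sub, mul_assoc _ _ (φ z), ← map_mul, inv_mul_cancel₀ hz0, map_one, mul_one, hu',
        mul_assoc, Units.inv_mul, mul_one, neg_sub]
    rw [this]
    exact L.neg_mem (L.mul_mem_left _ hz)
  have h1 := Ideal.norm_le_one_of_sub_mem hL.ne_top φ hu hC hz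
  have h2 := Ideal.norm_le_one_of_sub_mem hL.ne_top φ hu' hC' hz'
  rw [norm_inv] at h2
  have h3 : ‖z‖ = 1 := le_antisymm h1 ((inv_le_one₀ (norm_pos_iff.2 hz0)).1 h2)
  obtain ⟨U, hU⟩ := hT ⟨z, mem_sphere_zero_iff_norm.2 h3⟩
  refine hunit U ?_
  -- Both `T` and `u - φ z` lie in `L`, so elements of `L` approximate the unit `U`; maximal left
  -- ideals are closed.
  have hcl : (U : A) ∈ closure (L : Set A) := by
    rw [Metric.mem_closure_iff]
    intro ε hε
    obtain ⟨a, ha⟩ := hU ε hε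
    refine ⟨T - a * (u - φ z), L.sub_mem hTL (L.mul_mem_left _ hz), ?_⟩
    rw [dist_comm, dist_eq_norm, sub_right_comm]
    exact ha
  rwa [(Ideal.IsMaximal.isClosed (I := L)).closure_eq] at hcl

/-- The local principle of Allan and Douglas for the closed subalgebra generated by a central
element `u` such that `u` and `u⁻¹` are power bounded. -/
theorem isUnit_of_local (φ : ℂ →ₐ[ℝ] A) (hφ : ∀ z a, φ z * a = a * φ z)
    (u : Aˣ) (hu : ∀ a : A, u * a = a * u) (C : ℝ) (hC : ∀ k : ℕ, ‖((u : A)) ^ k‖ ≤ C)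
    (hC' : ∀ k : ℕ, ‖((u⁻¹ : Aˣ) : A) ^ k‖ ≤ C) (T : A)
    (hT : ∀ M : Circle, ∃ U : Aˣ, ∀ ε > 0, ∃ a, ‖T - U - a * (u - φ M)‖ < ε) :
    IsUnit T := by
  obtain ⟨R, hR⟩ := exists_left_inv_of_local φ hφ u hu C hC hC' T hT
  -- The left inverse `R` is locally `U⁻¹`: multiply the approximation of `T` by `R` on the left and
  -- by `U⁻¹` on the right. So `R` has a left inverse too, which must be `T`.
  obtain ⟨Q, hQ⟩ := exists_left_inv_of_local φ hφ u hu C hC hC' R fun M => by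
    obtain ⟨U, hU⟩ := hT M
    refine ⟨U⁻¹, fun ε hε => ?_⟩
    set K := ‖R‖ * ‖((U⁻¹ : Aˣ) : A)‖ with hK
    have hK0 : 0 ≤ K := by positivity
    obtain ⟨a, ha⟩ := hU (ε / (K + 1)) (by positivity)
    refine ⟨-(R * a * ((U⁻¹ : Aˣ) : A)), ?_⟩
    have hcen : ((U⁻¹ : Aˣ) : A) * (u - φ M) = (u - φ M) * ((U⁻¹ : Aˣ) : A) := by
      rw [mul_sub, sub_mul, hu, hφ]
    have : R - ((U⁻¹ : Aˣ) : A) - -(R * a * ((U⁻¹ : Aˣ) : A)) * (u - φ M) =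
        -(R * (T - U - a * (u - φ M)) * ((U⁻¹ : Aˣ) : A)) := by
      rw [neg_mul, mul_assoc (R * a), hcen]
      generalize (u : A) - φ M = w
      rw [mul_sub, mul_sub, hR, sub_mul, sub_mul, one_mul, mul_assoc R U, Units.mul_inv, mul_one]
      noncomm_ring
    rw [this, norm_neg]
    calc ‖R * (T - U - a * (u - φ M)) * ((U⁻¹ : Aˣ) : A)‖
        ≤ ‖R‖ * ‖T - U - a * (u - φ M)‖ * ‖((U⁻¹ : Aˣ) : A)‖ :=
          (norm_mul_le _ _).trans (by gcongr; exact norm_mul_le _ _)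
      _ ≤ K * (ε / (K + 1)) := by
          rw [hK, mul_right_comm]
          gcongr
      _ < ε := by
          rw [mul_div_assoc', div_lt_iff₀ (by positivity)]
          nlinarith
  have hQT : Q = T := by rw [← mul_one Q, ← hR, ← mul_assoc, hQ, one_mul]
  exact ⟨⟨T, R, by rw [← hQT, hQ], hR⟩, rfl⟩

end LocalPrinciple

namespace CayleyDickson

/-! ### Complex scalars on the complexified sequences -/

section Complexification

variable {Y Z : Type*} [NormedAddCommGroup Y] [NormedSpace ℝ Y] [NormedAddCommGroup Z]
  [NormedSpace ℝ Z]

@[simp] theorem Cplx.smul_fst (c : ℂ) (x : Cplx Y) :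
    (Cplx.smul c x).fst = c.re • x.fst - c.im • x.snd := by
  simp [Cplx.smul, Cplx.inRe, Cplx.inIm, Cplx.re, Cplx.im, sub_eq_add_neg]

@[simp] theorem Cplx.smul_snd (c : ℂ) (x : Cplx Y) :
    (Cplx.smul c x).snd = c.re • x.snd + c.im • x.fst := by
  simp [Cplx.smul, Cplx.inRe, Cplx.inIm, Cplx.re, Cplx.im]

theorem Cplx.smul_one (x : Cplx Y) : Cplx.smul 1 x = x := by
  rw [Cplx.ext_iff']; constructor <;> simp

theorem Cplx.smul_smul (c d : ℂ) (x : Cplx Y) :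
    Cplx.smul c (Cplx.smul d x) = Cplx.smul (c * d) x := by
  rw [Cplx.ext_iff']
  constructor <;> simp <;> module

theorem Cplx.smul_eq (c : ℂ) :
    (Cplx.smul c : Cplx Y →L[ℝ] Cplx Y) =
      c.re • ContinuousLinearMap.id ℝ _ + c.im • Cplx.smul Complex.I := by
  ext x : 1
  rw [Cplx.ext_iff']
  constructor <;> simp [sub_eq_add_neg]

theorem Cplx.map_smul (A : Y →L[ℝ] Z) (c : ℂ) (x : Cplx Y) :
    Cplx.map A (Cplx.smul c x) = Cplx.smul c (Cplx.map A x) := by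
  rw [Cplx.ext_iff']; constructor <;> simp

/-- Termwise multiplication by a complex number on `l_∞(ℤ, Y ⊕ Y𝐢)`. -/
noncomputable def cmul (c : ℂ) : LInf (Cplx Y) →L[ℝ] LInf (Cplx Y) := LInf.map (Cplx.smul c)

@[simp] theorem cmul_apply (c : ℂ) (x : LInf (Cplx Y)) (k : ℤ) :
    cmul c x k = Cplx.smul c (x k) := rfl

theorem cmul_mul (c d : ℂ) :
    (cmul c * cmul d : LInf (Cplx Y) →L[ℝ] LInf (Cplx Y)) = cmul (c * d) := by
  ext x k : 3
  exact Cplx.smul_smul c d (x k)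

theorem cmul_one : (cmul 1 : LInf (Cplx Y) →L[ℝ] LInf (Cplx Y)) = 1 := by
  ext x k : 3
  exact Cplx.smul_one (x k)

theorem cmul_eq (c : ℂ) : (cmul c : LInf (Cplx Y) →L[ℝ] LInf (Cplx Y)) =
    algebraMap ℝ _ c.re + c.im • cmul Complex.I := by
  rw [cmul, Cplx.smul_eq, map_add, map_smul, map_smul]
  rfl

end Complexification

/-! ### Shifts, blocks of length `n` and periodic lifts -/

section Shift

variable {Z : Type*} [NormedAddCommGroup Z] [NormedSpace ℝ Z]

@[simp] theorem shift_apply (m : ℤ) (x : LInf Z) (k : ℤ) : shift m x k = x (m + k) := rfl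

theorem shift_mul (m l : ℤ) :
    (shift m * shift l : LInf Z →L[ℝ] LInf Z) = shift (m + l) := by
  ext x k : 3
  change x (l + (m + k)) = x (m + l + k)
  rw [add_left_comm, add_assoc]

theorem shift_zero : (shift 0 : LInf Z →L[ℝ] LInf Z) = 1 := by
  ext x k : 3
  change x (0 + k) = x k
  rw [zero_add]

theorem norm_shift_apply_le (m : ℤ) (x : LInf Z) : ‖shift m x‖ ≤ ‖x‖ :=
  lp.norm_le_of_forall_le' _ fun _ => lp.norm_apply_le_norm (by simp) x _

theorem shift_pow (m : ℤ) (k : ℕ) : (shift m : LInf Z →L[ℝ] LInf Z) ^ k = shift (k * m) := by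
  induction k with
  | zero => simp [shift_zero]
  | succ k ih => rw [pow_succ, ih, shift_mul]; congr 1; push_cast; ring

theorem norm_shift_pow_le (m : ℤ) (k : ℕ) : ‖(shift m : LInf Z →L[ℝ] LInf Z) ^ k‖ ≤ 1 := by
  rw [shift_pow]
  exact ContinuousLinearMap.opNorm_le_bound _ zero_le_one fun x => by
    rw [one_mul]; exact norm_shift_apply_le _ x

variable (n : ℕ)

theorem commute_shift_mul {R : LInf Z →L[ℝ] LInf Z} (hR : Commute (shift (n : ℤ)) R) (q : ℤ) :
    Commute (shift (n * q)) R := by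
  induction q using Int.induction_on with
  | zero => rw [mul_zero, shift_zero]; exact Commute.one_left R
  | succ q ih => rw [mul_add, mul_one, ← shift_mul]; exact ih.mul_left hR
  | pred q ih =>
    rw [mul_sub, mul_one, sub_eq_add_neg, ← shift_mul]
    refine ih.mul_left ?_
    have h1 : shift (n : ℤ) * shift (-n : ℤ) = (1 : LInf Z →L[ℝ] LInf Z) := by
      rw [shift_mul, add_neg_cancel, shift_zero]
    have h2 : shift (-n : ℤ) * shift (n : ℤ) = (1 : LInf Z →L[ℝ] LInf Z) := by
      rw [shift_mul, neg_add_cancel, shift_zero]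
    change shift (-n : ℤ) * R = R * shift (-n : ℤ)
    calc shift (-n : ℤ) * R = shift (-n : ℤ) * (R * shift (n : ℤ)) * shift (-n : ℤ) := by
          rw [mul_assoc, mul_assoc, h1, mul_one]
      _ = R * shift (-n : ℤ) := by rw [← hR.eq, ← mul_assoc, h2, one_mul]

/-- The operator that replaces the values outside of `{0, …, n - 1}` by zero. -/
noncomputable def cutoff : LInf Z →L[ℝ] LInf Z :=
  LInf.diag (fun k => if k / n = 0 then ContinuousLinearMap.id ℝ Z else 0) 1 fun k => by
    split_ifs
    · exact ContinuousLinearMap.norm_id_le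
    · simp

theorem cutoff_apply (x : LInf Z) (k : ℤ) : cutoff n x k = if k / n = 0 then x k else 0 := by
  change (if k / n = 0 then ContinuousLinearMap.id ℝ Z else 0) (x k) = _
  split_ifs <;> rfl

/-- The operator that replaces by zero the values outside of the blocks of length `n` numbered
by `-m, …, m`. -/
noncomputable def truncation (m : ℕ) : LInf Z →L[ℝ] LInf Z :=
  ∑ q ∈ Finset.Icc (-m : ℤ) m, shift (n * -q) * cutoff n * shift (n * q)

/-- In the application `d = S(n) - M^n`, `C q = M^(nq)`, and `K` extends block `0`
quasi-periodically. On block `q`, `1 - K` then amounts to `S(nq) - M^(nq)`, a multiple of `d`;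
summing over finitely many blocks makes the truncation of `1 - K` a multiple of `d`. -/
theorem sum_cutoff_mul_eq (m : ℕ) {K d : LInf Z →L[ℝ] LInf Z} {C g : ℤ → LInf Z →L[ℝ] LInf Z}
    (hg : ∀ q : ℤ, shift (n * q) - C q = g q * d)
    (hK : ∀ q : ℤ, cutoff n * (shift (n * q) * K) = cutoff n * C q) :
    (∑ q ∈ Finset.Icc (-m : ℤ) m, shift (n * -q) * cutoff n * g q) * d =
      truncation n m * (1 - K) := by
  rw [truncation, Finset.sum_mul, Finset.sum_mul]
  refine Finset.sum_congr rfl fun q _ => ?_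
  rw [mul_assoc _ (g q), ← hg, mul_sub, mul_sub, mul_one]
  simp only [mul_assoc]
  rw [hK]

variable [NeZero n]

@[simp] theorem window_apply (x : LInf Z) (j : ZMod n) : window n x j = x (j.val : ℤ) := rfl

@[simp] theorem periodicSeq_apply (x : ZMod n → Z) (k : ℤ) :
    periodicSeq n x k = x (k : ZMod n) := rfl

/-- The `n`-periodic operator whose block of values at the indices `0, …, n - 1` is given
by `H`. -/
noncomputable def blockLift (H : LInf Z →L[ℝ] (ZMod n → Z)) : LInf Z →L[ℝ] LInf Z :=
  have bound : ∀ (x : LInf Z) (k : ℤ), ‖H (shift (n * (k / n)) x) (k : ZMod n)‖ ≤ ‖H‖ * ‖x‖ :=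
    fun x _ => (norm_le_pi_norm _ _).trans <| (H.le_opNorm _).trans <|
      mul_le_mul_of_nonneg_left (norm_shift_apply_le _ x) (norm_nonneg _)
  LinearMap.mkContinuous
    { toFun := fun x => ⟨fun k => H (shift (n * (k / n)) x) (k : ZMod n),
        LInf.memℓp_of_le x _ ‖H‖ (bound x)⟩
      map_add' := fun x y => by ext k; simp; rfl
      map_smul' := fun c x => by ext k; simp } ‖H‖
    fun x => lp.norm_le_of_forall_le' _ (bound x)

@[simp] theorem blockLift_apply (H : LInf Z →L[ℝ] (ZMod n → Z)) (x : LInf Z) (k : ℤ) :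
    blockLift n H x k = H (shift (n * (k / n)) x) (k : ZMod n) := rfl

theorem norm_blockLift_le (H : LInf Z →L[ℝ] (ZMod n → Z)) : ‖blockLift n H‖ ≤ ‖H‖ :=
  LinearMap.mkContinuous_norm_le _ (norm_nonneg _) fun x =>
    lp.norm_le_of_forall_le' _ fun _ => (norm_le_pi_norm _ _).trans <|
      (H.le_opNorm _).trans <| mul_le_mul_of_nonneg_left (norm_shift_apply_le _ x) (norm_nonneg _)

theorem window_blockLift (H : LInf Z →L[ℝ] (ZMod n → Z)) (x : LInf Z) :
    window n (blockLift n H x) = H x := by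
  ext j : 1
  have h : ((j.val : ℤ) / n) = 0 :=
    Int.ediv_eq_zero_of_lt (by positivity) (by exact_mod_cast ZMod.val_lt j)
  rw [window_apply, blockLift_apply, h, mul_zero, shift_zero, Int.cast_natCast,
    ZMod.natCast_zmod_val]
  rfl

theorem commute_shift_blockLift (H : LInf Z →L[ℝ] (ZMod n → Z)) :
    Commute (shift (n : ℤ)) (blockLift n H) := by
  have hn : (n : ℤ) ≠ 0 := by exact_mod_cast NeZero.ne n
  ext x k : 3
  change H (shift (n * ((n + k) / n)) x) ((n + k : ℤ) : ZMod n) =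
    H ((shift (n * (k / n)) * shift n : LInf Z →L[ℝ] LInf Z) x) (k : ZMod n)
  rw [shift_mul, Int.add_ediv_of_dvd_left dvd_rfl, Int.ediv_self hn, mul_add, mul_one, add_comm]
  simp

theorem blockLift_comp (H : LInf Z →L[ℝ] (ZMod n → Z)) {R : LInf Z →L[ℝ] LInf Z}
    (hR : Commute (shift (n : ℤ)) R) : blockLift n (H ∘L R) = blockLift n H * R := by
  ext x k : 3
  change H ((R * shift (n * (k / n)) : LInf Z →L[ℝ] LInf Z) x) _ =
    H ((shift (n * (k / n)) * R : LInf Z →L[ℝ] LInf Z) x) _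
  rw [(commute_shift_mul n hR _).eq]

theorem blockLift_window : blockLift n (window n) = (1 : LInf Z →L[ℝ] LInf Z) := by
  ext x k : 3
  change x (n * (k / n) + ((k : ZMod n).val : ℤ)) = x k
  rw [ZMod.val_intCast, Int.mul_ediv_add_emod]

theorem blockLift_window_comp {R : LInf Z →L[ℝ] LInf Z}
    (hR : Commute (shift (n : ℤ)) R) : blockLift n (window n ∘L R) = R := by
  rw [blockLift_comp n _ hR, blockLift_window, one_mul]

theorem blockLift_sub (H H' : LInf Z →L[ℝ] (ZMod n → Z)) :
    blockLift n (H - H') = blockLift n H - blockLift n H' := by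
  ext x k : 3
  rfl

theorem truncation_apply (m : ℕ) (x : LInf Z) (k : ℤ) :
    truncation n m x k = if k / n ∈ Finset.Icc (-m : ℤ) m then x k else 0 := by
  have hn : (n : ℤ) ≠ 0 := by exact_mod_cast NeZero.ne n
  have h : ∀ q : ℤ, (shift (n * -q) * cutoff n * shift (n * q) : LInf Z →L[ℝ] LInf Z) x k =
      if k / n = q then x k else 0 := fun q => by
    change cutoff n (shift (n * q) x) (n * -q + k) = _
    have h1 : (n * -q + k) / n = 0 ↔ k / n = q := by
      rw [Int.mul_add_ediv_left _ _ hn, neg_add_eq_zero, eq_comm]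
    rw [cutoff_apply, shift_apply, mul_neg, add_neg_cancel_left, ← mul_neg]
    simp only [h1]
  rw [truncation, sum_apply, lp.coeFn_sum, Finset.sum_apply, Finset.sum_congr rfl fun q _ => h q]
  exact Finset.sum_ite_eq _ _ _

theorem one_sub_truncation_apply (m : ℕ) (x : LInf Z) (k : ℤ) :
    (1 - truncation n m) x k = if k / n ∈ Finset.Icc (-m : ℤ) m then 0 else x k := by
  change x k - truncation n m x k = _
  rw [truncation_apply]
  split_ifs <;> simp

theorem norm_one_sub_truncation_apply_le (m : ℕ) (x : LInf Z) : ‖(1 - truncation n m) x‖ ≤ ‖x‖ :=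
  lp.norm_le_of_forall_le (norm_nonneg x) fun k => by
    rw [one_sub_truncation_apply]
    split_ifs
    · simp
    · exact lp.norm_apply_le_norm (by simp) x k

/-- The values of a `c`-continuous operator on a window depend little on distant values. -/
theorem CContinuous.exists_norm_window_comp_le {R : LInf Z →L[ℝ] LInf Z} (hR : CContinuous R)
    {ε : ℝ} (hε : 0 < ε) : ∃ m : ℕ, ‖window n ∘L R ∘L (1 - truncation n m)‖ ≤ ε := by
  by_contra! h
  choose x hx hxε using fun m =>
    ContinuousLinearMap.exists_lt_apply_of_lt_opNorm _ (h m)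
  -- `c`-continuity yields some termwise limit, not its value. Interleaving with zeros forces the
  -- limit to be zero; since the window is finite, termwise convergence there is norm convergence,
  -- against the lower bound `ε`.
  let u : ℕ → LInf Z := fun m => if Even m then (1 - truncation n m) (x m) else 0
  have hu : ∀ m, ‖u m‖ ≤ 1 := fun m => by
    simp only [u]
    split_ifs
    · exact (norm_one_sub_truncation_apply_le n m _).trans (hx m).le
    · simp
  have hu0 : CConverges u 0 := fun k => by
    refine tendsto_const_nhds.congr' ?_
    filter_upwards [Filter.eventually_ge_atTop (k / n).natAbs] with m hm
    have hk : k / n ∈ Finset.Icc (-m : ℤ) m := by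
      rw [Finset.mem_Icc]; omega
    simp only [u]
    split_ifs
    · rw [one_sub_truncation_apply, if_pos hk]; simp
    · simp
  obtain ⟨y, hy⟩ := hR u ⟨1, hu⟩ ⟨0, hu0⟩
  have hy0 : ∀ k, y k = 0 := fun k => by
    have h1 := (hy k).comp (Filter.tendsto_atTop_mono (fun m : ℕ => (by omega : m ≤ 2 * m + 1))
      Filter.tendsto_id)
    have h2 : ((fun m => ‖R (u m) k - y k‖) ∘ fun m : ℕ => 2 * m + 1) = fun _ => ‖y k‖ := by
      funext m
      simp [u]
    rw [h2] at h1
    exact norm_eq_zero.1 (tendsto_nhds_unique tendsto_const_nhds h1)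
  have hw : Filter.Tendsto (fun m : ℕ => window n (R (u (2 * m)))) Filter.atTop (nhds 0) := by
    rw [tendsto_pi_nhds]
    intro j
    have h1 := (hy (j.val : ℤ)).comp
      (Filter.tendsto_atTop_mono (fun m : ℕ => (by omega : m ≤ 2 * m))
      Filter.tendsto_id)
    rw [hy0] at h1
    simp only [sub_zero] at h1
    exact tendsto_zero_iff_norm_tendsto_zero.2 h1
  obtain ⟨m, hm⟩ := (hw.norm.eventually (gt_mem_nhds (by simpa using hε))).exists
  refine lt_asymm hm ?_
  have := hxε (2 * m)
  simpa [u] using this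

/-- A periodic operator is the lift of its window, so the difference on the left is the lift of
`window n ∘L T` applied to what remains of `1 - K` after truncation. Lifting does not increase
norms. -/
theorem norm_sub_blockLift_le (m : ℕ) {T K R d : LInf Z →L[ℝ] LInf Z}
    (hT : Commute (shift (n : ℤ)) T) (hd : Commute (shift (n : ℤ)) d)
    (hR : R * d = truncation n m * (1 - K)) :
    ‖T - blockLift n (window n ∘L T ∘L K) - blockLift n (window n ∘L T ∘L R) * d‖ ≤
      ‖window n ∘L T ∘L (1 - truncation n m)‖ * ‖1 - K‖ := by
  have h : T - blockLift n (window n ∘L T ∘L K) - blockLift n (window n ∘L T ∘L R) * d =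
      blockLift n ((window n ∘L T ∘L (1 - truncation n m)) ∘L (1 - K)) := by
    rw [← blockLift_comp n _ hd]
    nth_rw 1 [← blockLift_window_comp n hT]
    rw [← blockLift_sub, ← blockLift_sub]
    congr 1
    ext x : 1
    have h1 : R (d x) = truncation n m (x - K x) := congrArg (fun Q => Q x) hR
    change window n (T x) - window n (T (K x)) - window n (T (R (d x))) =
      window n (T (x - K x - truncation n m (x - K x)))
    rw [h1, map_sub T (x - K x), map_sub T x, map_sub (window n), map_sub (window n)]
  rw [h]
  exact (norm_blockLift_le n _).trans (ContinuousLinearMap.opNorm_comp_le _ _)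

end Shift

/-- This is the divisibility of `a^q - b^q` by `a - b` for commuting units, including negative `q`,
with the quotient kept inside the subalgebra. -/
theorem exists_mem_sub_eq_mul_sub {R : Type*} [Ring R] [Algebra ℝ R] (A : Subalgebra ℝ R)
    (a b : ℤ → R) (ha0 : a 0 = 1) (hb0 : b 0 = 1) (ha : ∀ p q, a p * a q = a (p + q))
    (hb : ∀ p q, b p * b q = b (p + q)) (hab : ∀ p q, a p * b q = b q * a p)
    (haA : ∀ q, a q ∈ A) (hbA : ∀ q, b q ∈ A) (q : ℤ) :
    ∃ g ∈ A, a q - b q = g * (a 1 - b 1) := by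
  induction q using Int.induction_on with
  | zero => exact ⟨0, zero_mem _, by rw [ha0, hb0, sub_self, zero_mul]⟩
  | succ q ih =>
    obtain ⟨g, hg, h⟩ := ih
    refine ⟨a 1 * g + b q, add_mem (mul_mem (haA _) hg) (hbA _), ?_⟩
    rw [add_mul, mul_assoc, ← h, mul_sub, mul_sub, ha, hb, hab, sub_add_sub_cancel, add_comm 1]
  | pred q ih =>
    obtain ⟨g, hg, h⟩ := ih
    refine ⟨a (-1) * (g - b (-q - 1)), mul_mem (haA _) (sub_mem hg (hbA _)), ?_⟩
    rw [mul_assoc, sub_mul, ← h, mul_sub (b _), hb, sub_add_cancel, ← hab,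
      sub_sub_sub_cancel_right, mul_sub, ← mul_assoc, ha, ha, neg_add_cancel, ha0, one_mul,
      neg_add_eq_sub]

/-! ### The algebra of periodic operators and its symbols -/

section PeriodicOperators

variable {Y : Type*} [NormedAddCommGroup Y] [NormedSpace ℝ Y]

theorem commute_cmul {R : LInf (Cplx Y) →L[ℝ] LInf (Cplx Y)} (hR : Commute (cmul Complex.I) R)
    (c : ℂ) : Commute (cmul c) R := by
  rw [cmul_eq]
  exact (Algebra.commute_algebraMap_left _ _).add_left (hR.smul_left _)

/-- The algebra of the complex linear operators on `l_∞(ℤ, Y ⊕ Y𝐢)` that commute with `S(n)`. -/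
noncomputable def periodicOperators (n : ℕ) (Y : Type*) [NormedAddCommGroup Y] [NormedSpace ℝ Y] :
    Subalgebra ℝ (LInf (Cplx Y) →L[ℝ] LInf (Cplx Y)) :=
  Subalgebra.centralizer ℝ {shift (n : ℤ), cmul Complex.I}

theorem mem_periodicOperators {n : ℕ} {T : LInf (Cplx Y) →L[ℝ] LInf (Cplx Y)} :
    T ∈ periodicOperators n Y ↔ Commute (shift (n : ℤ)) T ∧ Commute (cmul Complex.I) T := by
  simp [periodicOperators, Subalgebra.mem_centralizer_iff, Commute, SemiconjBy]

instance (n : ℕ) [CompleteSpace Y] : CompleteSpace (periodicOperators n Y) :=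
  (Set.isClosed_centralizer _).completeSpace_coe

theorem shift_mem_periodicOperators (n : ℕ) (m : ℤ) : shift m ∈ periodicOperators n Y := by
  refine mem_periodicOperators.2 ⟨?_, ?_⟩
  · rw [commute_iff_eq, shift_mul, shift_mul, add_comm]
  · ext x k : 3
    rfl

theorem cmul_mem_periodicOperators (n : ℕ) (c : ℂ) : cmul c ∈ periodicOperators n Y := by
  refine mem_periodicOperators.2 ⟨?_, ?_⟩
  · ext x k : 3
    rfl
  · rw [commute_iff_eq, cmul_mul, cmul_mul, mul_comm]

theorem exists_shift_sub_cmul_eq (n : ℕ) {c : ℂ} (hc : c ≠ 0) (q : ℤ) :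
    ∃ g ∈ periodicOperators n Y,
      shift (Y := Cplx Y) (n * q) - cmul (Y := Y) (c ^ q) =
        g * (shift (Y := Cplx Y) n - cmul (Y := Y) c) := by
  have := exists_mem_sub_eq_mul_sub (periodicOperators n Y)
    (fun q => shift (Y := Cplx Y) (n * q)) (fun q => cmul (Y := Y) (c ^ q))
    (by simp only [mul_zero, shift_zero])
    (by simp only [zpow_zero, cmul_one])
    (fun p q => by simp only [shift_mul, mul_add])
    (fun p q => by simp only [cmul_mul, zpow_add₀ hc]) (fun p q => by ext x k : 3; rfl)
    (fun q => shift_mem_periodicOperators n _) (fun q => cmul_mem_periodicOperators n _) q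
  simpa only [mul_one, zpow_one] using this

theorem shift_mul_apply {n : ℕ} {M : Circle} {y : LInf (Cplx Y)}
    (hy : shift (n : ℤ) y = cmul ((M : ℂ) ^ n) y) (q : ℤ) :
    shift (n * q) y = cmul (((M : ℂ) ^ n) ^ q) y := by
  obtain ⟨g, -, hg⟩ := exists_shift_sub_cmul_eq (Y := Y) n
    (pow_ne_zero n (Circle.coe_ne_zero M)) q
  have h := congrArg (fun R => R y) hg
  change shift (n * q) y - cmul (((M : ℂ) ^ n) ^ q) y =
    g (shift (n : ℤ) y - cmul ((M : ℂ) ^ n) y) at h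
  rwa [hy, sub_self, map_zero, sub_eq_zero] at h

/-- Multiplication of a tuple by `𝐢`. -/
noncomputable def mulIPi (n : ℕ) (Y : Type*) [NormedAddCommGroup Y] [NormedSpace ℝ Y] :
    (ZMod n → Cplx Y) →L[ℝ] (ZMod n → Cplx Y) :=
  ContinuousLinearMap.piMap fun _ => Cplx.smul Complex.I

theorem mulIPi_apply {n : ℕ} (x : ZMod n → Cplx Y) (j : ZMod n) :
    mulIPi n Y x j = Cplx.smul Complex.I (x j) := rfl

variable (n : ℕ) [NeZero n]

/-- The extension of a tuple to a sequence `x` with `x(k) = M^k x_j` for `k ≡ j` modulo `n`. -/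
noncomputable def twist (M : Circle) : (ZMod n → Cplx Y) →L[ℝ] LInf (Cplx Y) :=
  D M ∘L periodicSeq n

/-- The left inverse `x ↦ (M^{-j} x(j))_{0 ≤ j < n}` of `twist n M`. -/
noncomputable def untwist (M : Circle) : LInf (Cplx Y) →L[ℝ] (ZMod n → Cplx Y) :=
  window n ∘L D M⁻¹

/-- The Fourier transform at `M` of an operator on `l_∞(ℤ, Y ⊕ Y𝐢)`. -/
noncomputable def symbol (T : LInf (Cplx Y) →L[ℝ] LInf (Cplx Y)) (M : Circle) :
    (ZMod n → Cplx Y) →L[ℝ] (ZMod n → Cplx Y) :=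
  untwist n M ∘L T ∘L twist n M

@[simp] theorem twist_apply (M : Circle) (x : ZMod n → Cplx Y) (k : ℤ) :
    twist n M x k = Cplx.smul ((M : ℂ) ^ k) (x k) := rfl

@[simp] theorem untwist_apply (M : Circle) (x : LInf (Cplx Y)) (j : ZMod n) :
    untwist n M x j = Cplx.smul ((M : ℂ)⁻¹ ^ (j.val : ℤ)) (x (j.val : ℤ)) := by
  rw [← Circle.coe_inv]
  rfl

theorem untwist_twist (M : Circle) (x : ZMod n → Cplx Y) : untwist n M (twist n M x) = x := by
  ext j : 1
  rw [untwist_apply, twist_apply, Cplx.smul_smul, inv_zpow, inv_mul_cancel₀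
    (zpow_ne_zero _ (Circle.coe_ne_zero M)), Cplx.smul_one, Int.cast_natCast, ZMod.natCast_zmod_val]

theorem twist_untwist_apply (M : Circle) (x : LInf (Cplx Y)) (k : ℤ) :
    twist n M (untwist n M x) k = Cplx.smul (((M : ℂ) ^ n) ^ (k / n)) (x (k % n)) := by
  rw [twist_apply, untwist_apply, ZMod.val_intCast, Cplx.smul_smul, inv_zpow, ← zpow_neg,
    ← zpow_add₀ (Circle.coe_ne_zero M), ← zpow_natCast, ← zpow_mul]
  congr 3
  linarith [Int.mul_ediv_add_emod k n]

theorem shift_twist (M : Circle) (x : ZMod n → Cplx Y) :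
    shift (n : ℤ) (twist n M x) = cmul ((M : ℂ) ^ n) (twist n M x) := by
  ext k : 2
  rw [shift_apply, cmul_apply, twist_apply, twist_apply, Cplx.smul_smul,
    zpow_add₀ (Circle.coe_ne_zero M), zpow_natCast]
  simp

/-- An eigenvector of `S(n)` for `M^n` is determined by one block, so `twist n M` maps onto the
eigenspace. -/
theorem twist_untwist_of_shift_eq {M : Circle} {y : LInf (Cplx Y)}
    (hy : shift (n : ℤ) y = cmul ((M : ℂ) ^ n) y) : twist n M (untwist n M y) = y := by
  ext k : 2
  rw [twist_untwist_apply, ← cmul_apply, ← shift_mul_apply hy, shift_apply,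
    Int.mul_ediv_add_emod]

variable {n}

theorem commute_apply {R T : LInf (Cplx Y) →L[ℝ] LInf (Cplx Y)} (h : Commute R T)
    (x : LInf (Cplx Y)) : T (R x) = R (T x) :=
  (congrArg (fun R => R x) h.eq).symm

/-- A periodic operator leaves the range of `twist n M` invariant and acts there as its symbol. -/
theorem twist_symbol {T : LInf (Cplx Y) →L[ℝ] LInf (Cplx Y)} (hT : T ∈ periodicOperators n Y)
    (M : Circle) (x : ZMod n → Cplx Y) : twist n M (symbol n T M x) = T (twist n M x) := by
  obtain ⟨h1, h2⟩ := mem_periodicOperators.1 hT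
  refine twist_untwist_of_shift_eq (y := T (twist n M x)) n ?_
  rw [← commute_apply h1, ← commute_apply (commute_cmul h2 _), shift_twist]

theorem symbol_mul {T R : LInf (Cplx Y) →L[ℝ] LInf (Cplx Y)} (hR : R ∈ periodicOperators n Y)
    (M : Circle) : symbol n (T * R) M = symbol n T M * symbol n R M := by
  ext x : 1
  change untwist n M (T (R (twist n M x))) = untwist n M (T (twist n M (symbol n R M x)))
  rw [twist_symbol hR]

theorem symbol_one (M : Circle) :
    symbol n (1 : LInf (Cplx Y) →L[ℝ] LInf (Cplx Y)) M = 1 := by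
  ext x : 1
  exact untwist_twist n M x

theorem isUnit_symbol {T : LInf (Cplx Y) →L[ℝ] LInf (Cplx Y)} (hT : T ∈ periodicOperators n Y)
    (h : IsUnit T) (M : Circle) : IsUnit (symbol n T M) := by
  obtain ⟨u, rfl⟩ := h
  have hinv : (↑u⁻¹ : LInf (Cplx Y) →L[ℝ] LInf (Cplx Y)) ∈ periodicOperators n Y :=
    mem_periodicOperators.2 ⟨(mem_periodicOperators.1 hT).1.units_inv_right,
      (mem_periodicOperators.1 hT).2.units_inv_right⟩
  exact ⟨⟨symbol n u M, symbol n ↑u⁻¹ M,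
    by rw [← symbol_mul hinv, Units.mul_inv, symbol_one],
    by rw [← symbol_mul hT, Units.inv_mul, symbol_one]⟩, rfl⟩

theorem twist_mulIPi (M : Circle) (x : ZMod n → Cplx Y) :
    twist n M (mulIPi n Y x) = cmul Complex.I (twist n M x) := by
  ext k : 2
  rw [twist_apply, mulIPi_apply, cmul_apply, twist_apply, Cplx.smul_smul, Cplx.smul_smul, mul_comm]

theorem untwist_cmul (M : Circle) (x : LInf (Cplx Y)) :
    untwist n M (cmul Complex.I x) = mulIPi n Y (untwist n M x) := by
  ext j : 1
  rw [untwist_apply, mulIPi_apply, cmul_apply, untwist_apply, Cplx.smul_smul, Cplx.smul_smul,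
    mul_comm]

theorem window_cmul (x : LInf (Cplx Y)) :
    window n (cmul Complex.I x) = mulIPi n Y (window n x) := by
  ext j : 1
  rw [window_apply, mulIPi_apply, cmul_apply, window_apply]

theorem commute_mulIPi_symbol {T : LInf (Cplx Y) →L[ℝ] LInf (Cplx Y)}
    (hT : T ∈ periodicOperators n Y) (M : Circle) : Commute (mulIPi n Y) (symbol n T M) := by
  ext x : 1
  change mulIPi n Y (untwist n M (T (twist n M x))) = untwist n M (T (twist n M (mulIPi n Y x)))
  rw [twist_mulIPi, commute_apply (mem_periodicOperators.1 hT).2, untwist_cmul]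

theorem blockLift_mem {H : LInf (Cplx Y) →L[ℝ] (ZMod n → Cplx Y)}
    (hH : ∀ x, H (cmul Complex.I x) = mulIPi n Y (H x)) :
    blockLift n H ∈ periodicOperators n Y := by
  refine mem_periodicOperators.2 ⟨commute_shift_blockLift n H, ?_⟩
  ext x k : 3
  exact (congrFun (hH (shift (n * (k / n)) x)) (k : ZMod n)).symm

/-- `untwist n M` depends only on the values in the window. -/
theorem untwist_periodicSeq_window (M : Circle) (x : LInf (Cplx Y)) :
    untwist n M (periodicSeq n (window n x)) = untwist n M x := by
  ext j : 1
  rw [untwist_apply, untwist_apply, periodicSeq_apply, window_apply, Int.cast_natCast,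
    ZMod.natCast_zmod_val]

theorem window_twist_untwist (M : Circle) (x : LInf (Cplx Y)) :
    window n (twist n M (untwist n M x)) = window n x := by
  ext j : 1
  have h : ((j.val : ℤ)) < n := by exact_mod_cast ZMod.val_lt j
  rw [window_apply, twist_untwist_apply, Int.ediv_eq_zero_of_lt (by positivity) h, zpow_zero,
    Cplx.smul_one, Int.emod_eq_of_lt (by positivity) h, window_apply]

/-- The periodic operator that acts on each block separately, and on the range of `twist n M`
as `twist n M ∘ F ∘ untwist n M`. -/
noncomputable def blockDiag (n : ℕ) [NeZero n] (Y : Type*) [NormedAddCommGroup Y]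
    [NormedSpace ℝ Y] (M : Circle) (F : (ZMod n → Cplx Y) →L[ℝ] (ZMod n → Cplx Y)) :
    LInf (Cplx Y) →L[ℝ] LInf (Cplx Y) :=
  blockLift n (window n ∘L twist n M ∘L F ∘L untwist n M)

theorem blockDiag_mem (M : Circle) {F : (ZMod n → Cplx Y) →L[ℝ] (ZMod n → Cplx Y)}
    (hF : Commute (mulIPi n Y) F) : blockDiag n Y M F ∈ periodicOperators n Y := by
  refine blockLift_mem fun x => ?_
  change window n (twist n M (F (untwist n M (cmul Complex.I x)))) =
    mulIPi n Y (window n (twist n M (F (untwist n M x))))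
  have h : ∀ y, F (mulIPi n Y y) = mulIPi n Y (F y) := fun y =>
    (congrArg (fun R => R y) hF.eq).symm
  rw [untwist_cmul, h, twist_mulIPi, window_cmul]

theorem blockDiag_apply (M : Circle) (F : (ZMod n → Cplx Y) →L[ℝ] (ZMod n → Cplx Y))
    (x : LInf (Cplx Y)) (k : ℤ) : blockDiag n Y M F x k =
      window n (twist n M (F (untwist n M (shift (n * (k / n)) x)))) (k : ZMod n) := rfl

/-- `untwist n M` sees only block `0`, where `blockDiag n Y M F` is `F` conjugated by the twist.
This gives the multiplicativity of `blockDiag`. -/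
theorem untwist_blockDiag (M : Circle) (F : (ZMod n → Cplx Y) →L[ℝ] (ZMod n → Cplx Y))
    (x : LInf (Cplx Y)) : untwist n M (blockDiag n Y M F x) = F (untwist n M x) := by
  have h : window n (blockDiag n Y M F x) = window n (twist n M (F (untwist n M x))) :=
    window_blockLift n _ x
  rw [← untwist_periodicSeq_window M (blockDiag n Y M F x), h, untwist_periodicSeq_window,
    untwist_twist]

theorem blockDiag_blockDiag_apply (M : Circle) (F G : (ZMod n → Cplx Y) →L[ℝ] (ZMod n → Cplx Y))
    (x : LInf (Cplx Y)) : blockDiag n Y M F (blockDiag n Y M G x) = blockDiag n Y M (F ∘L G) x := by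
  have hG : Commute (shift (Y := Cplx Y) n) (blockDiag n Y M G) := commute_shift_blockLift n _
  have h : ∀ q : ℤ, shift (Y := Cplx Y) (n * q) (blockDiag n Y M G x) =
      blockDiag n Y M G (shift (Y := Cplx Y) (n * q) x) :=
    fun q => (commute_apply (commute_shift_mul n hG q) x).symm
  ext k : 2
  rw [blockDiag_apply, blockDiag_apply, h, untwist_blockDiag]
  rfl

theorem blockDiag_mul (M : Circle) (F G : (ZMod n → Cplx Y) →L[ℝ] (ZMod n → Cplx Y)) :
    blockDiag n Y M F * blockDiag n Y M G = blockDiag n Y M (F * G) := by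
  ext x : 1
  exact blockDiag_blockDiag_apply M F G x

theorem blockDiag_one (M : Circle) :
    blockDiag n Y M (1 : (ZMod n → Cplx Y) →L[ℝ] (ZMod n → Cplx Y)) = 1 := by
  rw [← blockLift_window n, blockDiag]
  congr 1
  ext x : 1
  exact window_twist_untwist M x

theorem blockDiag_symbol {T : LInf (Cplx Y) →L[ℝ] LInf (Cplx Y)} (hT : T ∈ periodicOperators n Y)
    (M : Circle) :
    blockDiag n Y M (symbol n T M) = blockLift n (window n ∘L T ∘L twist n M ∘L untwist n M) := by
  rw [blockDiag]
  congr 1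
  ext x : 1
  exact congrArg (window n) (twist_symbol hT M _)

end PeriodicOperators

/-! ### The extension of `B` and local invertibility -/

variable {Y : Type*} [NormedAddCommGroup Y] [NormedSpace ℝ Y] {n : ℕ}

theorem cutoff_cmul (x : LInf (Cplx Y)) :
    cutoff n (cmul Complex.I x) = cmul Complex.I (cutoff n x) := by
  ext k : 2
  rw [cutoff_apply, cmul_apply, cmul_apply, cutoff_apply]
  split_ifs
  · rfl
  · rw [map_zero]

theorem extension_fst (B : LInf Y →L[ℝ] LInf Y) (x : LInf (Cplx Y)) (k : ℤ) :
    (extension B x k).fst = B (LInf.map Cplx.re x) k := by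
  simp [extension, Cplx.inRe, Cplx.inIm]

theorem extension_snd (B : LInf Y →L[ℝ] LInf Y) (x : LInf (Cplx Y)) (k : ℤ) :
    (extension B x k).snd = B (LInf.map Cplx.im x) k := by
  simp [extension, Cplx.inRe, Cplx.inIm]

theorem extension_mem {B : LInf Y →L[ℝ] LInf Y} (hB : IsPeriodic n B) :
    extension B ∈ periodicOperators n Y := by
  have hs : ∀ x k, B (shift (n : ℤ) x) k = B x (n + k) := fun x k =>
    (congrArg (fun R => R x k) hB.shift_comm).symm
  refine mem_periodicOperators.2 ⟨?_, ?_⟩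
  · ext x k : 3
    change extension B x (n + k) = extension B (shift (n : ℤ) x) k
    rw [Cplx.ext_iff', extension_fst, extension_fst, extension_snd, extension_snd, ← hs, ← hs]
    exact ⟨rfl, rfl⟩
  · ext x k : 3
    change Cplx.smul Complex.I (extension B x k) = extension B (cmul Complex.I x) k
    have h1 : LInf.map Cplx.re (cmul Complex.I x) = -LInf.map Cplx.im x := by
      ext k : 2
      change (Cplx.smul Complex.I (x k)).fst = -(x k).snd
      simp
    have h2 : LInf.map Cplx.im (cmul Complex.I x) = LInf.map Cplx.re x := by
      ext k : 2
      change (Cplx.smul Complex.I (x k)).snd = (x k).fst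
      simp
    rw [Cplx.ext_iff', extension_fst, extension_snd, Cplx.smul_fst, Cplx.smul_snd, extension_fst,
      extension_snd, h1, h2, map_neg]
    simp

theorem CConverges.map {Z Z' : Type*} [NormedAddCommGroup Z] [NormedSpace ℝ Z]
    [NormedAddCommGroup Z'] [NormedSpace ℝ Z'] {u : ℕ → LInf Z} {x : LInf Z}
    (h : CConverges u x) (A : Z →L[ℝ] Z') :
    CConverges (fun m => LInf.map A (u m)) (LInf.map A x) := fun k => by
  refine squeeze_zero (fun _ => norm_nonneg _) (fun m => ?_)
    (by simpa using (h k).const_mul ‖A‖)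
  rw [LInf.map_apply, LInf.map_apply, ← map_sub]
  exact A.le_opNorm _

theorem CConverges.add {Z : Type*} [NormedAddCommGroup Z] [NormedSpace ℝ Z] {u w : ℕ → LInf Z}
    {x y : LInf Z} (h : CConverges u x) (h' : CConverges w y) :
    CConverges (fun m => u m + w m) (x + y) := fun k => by
  refine squeeze_zero (fun _ => norm_nonneg _) (fun m => ?_)
    (by simpa using (h k).add (h' k))
  rw [lp.coeFn_add, lp.coeFn_add, Pi.add_apply, Pi.add_apply, add_sub_add_comm]
  exact norm_add_le _ _

theorem IsPeriodic.map_sub {B : LInf Y →L[ℝ] LInf Y} (hB : IsPeriodic n B) (A : Y →L[ℝ] Y) :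
    IsPeriodic n (LInf.map A - B) where
  cContinuous := by
    rintro u hC ⟨x, hx⟩
    obtain ⟨y, hy⟩ := hB.cContinuous u hC ⟨x, hx⟩
    have h : ∀ m, (LInf.map A - B) (u m) =
        LInf.map A (u m) + LInf.map (-ContinuousLinearMap.id ℝ Y) (B (u m)) := fun m => by
      ext k : 2
      exact sub_eq_add_neg _ _
    simp only [h]
    exact ⟨_, (hx.map A).add (hy.map (-ContinuousLinearMap.id ℝ Y))⟩
  shift_comm := by
    rw [ContinuousLinearMap.comp_sub, ContinuousLinearMap.sub_comp, hB.shift_comm]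
    rfl

/-- The unit of the algebra of periodic operators given by the shift by the period. -/
noncomputable def shiftUnit (n : ℕ) (Y : Type*) [NormedAddCommGroup Y] [NormedSpace ℝ Y] :
    (periodicOperators n Y)ˣ where
  val := ⟨shift (n : ℤ), shift_mem_periodicOperators n _⟩
  inv := ⟨shift (-n : ℤ), shift_mem_periodicOperators n _⟩
  val_inv := Subtype.ext <| by
    change shift (Y := Cplx Y) n * shift (Y := Cplx Y) (-n) = 1
    rw [shift_mul, add_neg_cancel, shift_zero]
  inv_val := Subtype.ext <| by
    change shift (Y := Cplx Y) (-n) * shift (Y := Cplx Y) n = 1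
    rw [shift_mul, neg_add_cancel, shift_zero]

/-- The complex numbers as periodic operators. -/
noncomputable def complexOperators (n : ℕ) (Y : Type*) [NormedAddCommGroup Y] [NormedSpace ℝ Y] :
    ℂ →ₐ[ℝ] periodicOperators n Y :=
  Complex.liftAux ⟨cmul Complex.I, cmul_mem_periodicOperators n _⟩ <| Subtype.ext <| by
    change cmul (Y := Y) Complex.I * cmul (Y := Y) Complex.I = -1
    rw [cmul_mul, Complex.I_mul_I, cmul_eq]
    simp

theorem coe_complexOperators (c : ℂ) :
    (complexOperators n Y c : LInf (Cplx Y) →L[ℝ] LInf (Cplx Y)) = cmul c := by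
  rw [cmul_eq, complexOperators, Complex.liftAux_apply]
  rfl

variable [NeZero n]

/-- The range of the twist consists of eigenvectors, so `S(nq)` acts as `M^(nq)`, and `twist n M ∘L
untwist n M` fixes block `0`. -/
theorem cutoff_shift_twist_untwist (M : Circle) (q : ℤ) :
    cutoff n * (shift (Y := Cplx Y) (n * q) * (twist n M ∘L untwist n M)) =
      cutoff n * cmul (Y := Y) (((M : ℂ) ^ n) ^ q) := by
  ext x : 1
  change cutoff n (shift (Y := Cplx Y) (n * q) (twist n M (untwist n M x))) =
    cutoff n (cmul (Y := Y) (((M : ℂ) ^ n) ^ q) x)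
  rw [shift_mul_apply (shift_twist n M _)]
  ext k : 2
  have hn : (n : ℤ) ≠ 0 := by exact_mod_cast NeZero.ne n
  rw [cutoff_apply, cutoff_apply]
  split_ifs with hk
  · have hk' : k % n = k := by
      have := Int.mul_ediv_add_emod k n
      rwa [hk, mul_zero, zero_add] at this
    rw [cmul_apply, cmul_apply, twist_untwist_apply, hk, zpow_zero, Cplx.smul_one, hk']
  · rfl

/-- Modulo the closed ideal generated by `S(n) - M^n`, a periodic `c`-continuous operator agrees
with a block diagonal operator given by its symbol at `M`. -/
theorem exists_norm_sub_blockDiag_lt {T : LInf (Cplx Y) →L[ℝ] LInf (Cplx Y)}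
    (hT : T ∈ periodicOperators n Y) (hc : CContinuous T) (M : Circle) {ε : ℝ} (hε : 0 < ε) :
    ∃ a ∈ periodicOperators n Y, ‖T - blockDiag n Y M (symbol n T M) -
      a * (shift (Y := Cplx Y) n - cmul (Y := Y) ((M : ℂ) ^ n))‖ < ε := by
  set K : LInf (Cplx Y) →L[ℝ] LInf (Cplx Y) := twist n M ∘L untwist n M with hK
  -- The added `1` keeps the denominator positive and makes the final bound strict.
  obtain ⟨m, hm⟩ := hc.exists_norm_window_comp_le n
    (show 0 < ε / (‖1 - K‖ + 1) by positivity)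
  choose g hg hgd using exists_shift_sub_cmul_eq (Y := Y) n
    (pow_ne_zero n (Circle.coe_ne_zero M))
  have hR := sum_cutoff_mul_eq n m hgd (cutoff_shift_twist_untwist M)
  set R : LInf (Cplx Y) →L[ℝ] LInf (Cplx Y) :=
    ∑ q ∈ Finset.Icc (-m : ℤ) m, shift (n * -q) * cutoff n * g q with hRdef
  have hRI : Commute (cmul (Y := Y) Complex.I) R := by
    refine Commute.sum_right _ _ _ fun q _ => ?_
    refine Commute.mul_right (Commute.mul_right ?_ ?_) (mem_periodicOperators.1 (hg q)).2
    · exact (mem_periodicOperators.1 (shift_mem_periodicOperators n _)).2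
    · ext x : 1
      exact (cutoff_cmul x).symm
  have hd : Commute (shift (Y := Cplx Y) n)
      (shift (Y := Cplx Y) n - cmul (Y := Y) ((M : ℂ) ^ n)) :=
    (Commute.refl _).sub_right (mem_periodicOperators.1 (cmul_mem_periodicOperators n _)).1
  -- `R` need not commute with `S(n)`; lifting the window of `T R` restores periodicity.
  refine ⟨blockLift n (window n ∘L T ∘L R), blockLift_mem fun x => ?_, ?_⟩
  · change window n (T (R (cmul (Y := Y) Complex.I x))) = mulIPi n Y (window n (T (R x)))
    rw [commute_apply hRI, commute_apply (mem_periodicOperators.1 hT).2, window_cmul]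
  · rw [blockDiag_symbol hT]
    refine (norm_sub_blockLift_le n m (mem_periodicOperators.1 hT).1 hd hR).trans_lt ?_
    calc _ ≤ ε / (‖1 - K‖ + 1) * ‖1 - K‖ := by gcongr
      _ < ε := by
        rw [div_mul_eq_mul_div, div_lt_iff₀ (by positivity)]
        nlinarith [norm_nonneg (1 - K)]

theorem isUnit_of_isUnit_symbol [CompleteSpace Y] {T : LInf (Cplx Y) →L[ℝ] LInf (Cplx Y)}
    (hT : T ∈ periodicOperators n Y) (hc : CContinuous T) (h : ∀ M, IsUnit (symbol n T M)) :
    IsUnit T := by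
  suffices IsUnit (⟨T, hT⟩ : periodicOperators n Y) from this.map (periodicOperators n Y).val
  refine isUnit_of_local (complexOperators n Y) (fun c a => Subtype.ext ?_) (shiftUnit n Y)
    (fun a => Subtype.ext ?_) 1 (fun k => norm_shift_pow_le _ k) (fun k => norm_shift_pow_le _ k) _
    fun N => ?_
  · change (complexOperators n Y c : LInf (Cplx Y) →L[ℝ] LInf (Cplx Y)) * a =
      a * complexOperators n Y c
    rw [coe_complexOperators]
    exact commute_cmul (mem_periodicOperators.1 a.2).2 c
  · exact (mem_periodicOperators.1 a.2).1
  -- Localization is over the values `N` of `S(n)`, symbols are indexed by `M`; any `n`-th root of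
  -- `N` serves.
  · obtain ⟨M, hM⟩ : ∃ M : Circle, M ^ n = N := by
      refine ⟨Circle.exp (Complex.arg N / n), ?_⟩
      rw [← Circle.exp_natCast_mul, mul_div_cancel₀ _ (Nat.cast_ne_zero.2 (NeZero.ne n)),
        Circle.exp_arg]
    obtain ⟨F, hF⟩ := h M
    have hcomm : Commute (mulIPi n Y) F := by
      rw [hF]
      exact commute_mulIPi_symbol hT M
    refine ⟨⟨⟨blockDiag n Y M F, blockDiag_mem M hcomm⟩,
      ⟨blockDiag n Y M ↑F⁻¹, blockDiag_mem M hcomm.units_inv_right⟩, Subtype.ext ?_,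
      Subtype.ext ?_⟩, fun ε hε => ?_⟩
    · exact (blockDiag_mul M _ _).trans (by rw [Units.mul_inv, blockDiag_one]; rfl)
    · exact (blockDiag_mul M _ _).trans (by rw [Units.inv_mul, blockDiag_one]; rfl)
    · obtain ⟨a, ha, hlt⟩ := exists_norm_sub_blockDiag_lt hT hc M hε
      refine ⟨⟨a, ha⟩, ?_⟩
      have hφ : (complexOperators n Y N : LInf (Cplx Y) →L[ℝ] LInf (Cplx Y)) =
          cmul ((M : ℂ) ^ n) := by
        rw [coe_complexOperators, ← hM]
        rfl
      rw [← hF, ← hφ] at hlt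
      exact hlt

/-! ### Passage back to `B` and `zI - B` -/

theorem CContinuous.extension {B : LInf Y →L[ℝ] LInf Y} (hB : CContinuous B) :
    CContinuous (extension B) := by
  rintro u ⟨C, hC⟩ ⟨x, hx⟩
  have hb : ∀ A : Cplx Y →L[ℝ] Y, ∃ C' : ℝ, ∀ m, ‖LInf.map A (u m)‖ ≤ C' := fun A =>
    ⟨‖LInf.map A‖ * C, fun m => ((LInf.map A).le_opNorm _).trans (by gcongr; exact hC m)⟩
  obtain ⟨y, hy⟩ := hB _ (hb Cplx.re) ⟨_, hx.map Cplx.re⟩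
  obtain ⟨z, hz⟩ := hB _ (hb Cplx.im) ⟨_, hx.map Cplx.im⟩
  exact ⟨_, (hy.map Cplx.inRe).add (hz.map Cplx.inIm)⟩

theorem extension_sub (A B : LInf Y →L[ℝ] LInf Y) :
    extension (A - B) = extension A - extension B := by
  ext x k : 3
  change _ = extension A x k - extension B x k
  rw [Cplx.ext_iff', WithLp.sub_fst, WithLp.sub_snd]
  simp only [extension_fst, extension_snd]
  exact ⟨rfl, rfl⟩

theorem extension_map (A : Y →L[ℝ] Y) : extension (LInf.map A) = LInf.map (Cplx.map A) := by
  ext x k : 3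
  rw [Cplx.ext_iff', extension_fst, extension_snd, LInf.map_apply, LInf.map_apply, LInf.map_apply,
    Cplx.map_fst, Cplx.map_snd]
  exact ⟨rfl, rfl⟩

theorem symbol_map (A : Y →L[ℝ] Y) (M : Circle) :
    symbol n (LInf.map (Cplx.map A)) M = ContinuousLinearMap.piMap fun _ => Cplx.map A := by
  ext x : 1
  change untwist n M (LInf.map (Cplx.map A) (twist n M x)) = fun j => Cplx.map A (x j)
  have h : LInf.map (Cplx.map A) (twist n M x) = twist n M (fun j => Cplx.map A (x j)) := by
    ext k : 2
    rw [LInf.map_apply, twist_apply, twist_apply, Cplx.map_smul]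
  rw [h, untwist_twist]

theorem symbol_sub (T R : LInf (Cplx Y) →L[ℝ] LInf (Cplx Y)) (M : Circle) :
    symbol n (T - R) M = symbol n T M - symbol n R M := by
  ext x : 1
  exact map_sub (untwist n M) (T (twist n M x)) (R (twist n M x))

/-- An operator is invertible if and only if its Fourier transforms are. -/
theorem isUnit_extension_iff [CompleteSpace Y] {B : LInf Y →L[ℝ] LInf Y} (hB : IsPeriodic n B) :
    IsUnit (extension B) ↔ ∀ M, IsUnit (fourier n B M) :=
  -- `fourier n B M` is by definition `symbol n (extension B) M`.
  ⟨isUnit_symbol (extension_mem hB),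
    isUnit_of_isUnit_symbol (extension_mem hB) hB.cContinuous.extension⟩

end CayleyDickson

theorem corollary83 (v : ℕ) (hv : 2 ≤ v) (hv' : v ≤ 3) (Y : Type*) [NormedAddCommGroup Y]
    [NormedSpace ℝ Y] [CompleteSpace Y] [CayleyDickson.BanachOver v Y] (n : ℕ) [NeZero n]
    (B : CayleyDickson.LInf Y →L[ℝ] CayleyDickson.LInf Y) (hB : CayleyDickson.IsPeriodic n B) :
    CayleyDickson.spectrum v (CayleyDickson.extension B) =
      ⋃ M : Circle, CayleyDickson.spectrum v (CayleyDickson.fourier n B M) := by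
  open CayleyDickson in
  ext z
  -- `zI - B` is itself periodic, so the invertibility criterion applies to it for each `z`
  -- separately.
  have h := isUnit_extension_iff (hB.map_sub (BanachOver.lmul z))
  rw [extension_sub, extension_map] at h
  have h' : ∀ M, fourier n (LInf.map (BanachOver.lmul z) - B) M =
      BanachOver.lmul z - fourier n B M := fun M => by
    change symbol n (extension _) M = _
    rw [extension_sub, symbol_sub, extension_map, symbol_map]
    rfl
  simp only [h'] at h
  rw [Set.mem_iUnion]
  exact (not_congr h).trans not_forall
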